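/- Let $G$ be a finite abelian group of order $v$, written additively. A $\kappa$-element subset $D\subseteq G$ is a $(v,\kappa,\lambda,\mu)$-partial difference set (PDS) in $G$ if the multiset $\{d_1-d_2 : d_1,d_2\in D,\ d_1\ne d_2\}$ contains each nonzero element of $D$ exactly $\lambda$ times and each nonzero element of $G\setminus D$ exactly $\mu$ times. It is of negative Latin square type if its parameters are $(n^2,\ r(n+1),\ -n+r^2+3r,\ r^2+r)$ for some non-negative integers $n$ and $r$. Let $k$ and $\ell$ be integers with $\ell\ge 1$ and $0\le k\le \ell$, and suppose that it is not the case that $k=\ell$ and $\ell$ is even. Then the group $\mathbb Z_4^{2k}\times\mathbb Z_2^{4\ell-4k}$ contains a PDS with parameters $$\bigl(4^{2\ell},\ (4^\ell+1)(4^{\ell-1}-1),\ 4^{2\ell-2}-3\cdot 4^{\ell-1}-2,\ 4^{2\ell-2}-4^{\ell-1}\bigr),$$ and this PDS is of negative Latin square type. -/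

import Mathlib

/-- `D` is a `(v, k, l, m)`-partial difference set in the finite abelian group `G` (written
additively): `G` has order `v`, `D` has `k` elements, and the multiset of the differences `x - y`
of distinct elements `x, y` of `D` contains each nonzero element of `D` exactly `l` times and each
nonzero element outside `D` exactly `m` times. The parameters are integers, so that expressions
in them may be subtracted without truncation. -/
structure IsPartialDifferenceSet {G : Type*} [AddCommGroup G] [Fintype G] [DecidableEq G]
    (D : Finset G) (v k l m : ℤ) : Prop where
  card_group : (Fintype.card G : ℤ) = v
  card_set : (D.card : ℤ) = k
  count_mem : ∀ g ∈ D, g ≠ 0 →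
    ((D.offDiag.filter fun p => p.1 - p.2 = g).card : ℤ) = l
  count_notMem : ∀ g ∉ D, g ≠ 0 →
    ((D.offDiag.filter fun p => p.1 - p.2 = g).card : ℤ) = m

/-- `D` is a partial difference set of negative Latin square type: its parameters are
`(n², r(n - ε), εn + r² - 3εr, r² - εr)` with `ε = -1`, for some natural numbers `n` and `r`. -/
def IsNegativeLatinSquareType {G : Type*} [AddCommGroup G] [Fintype G] [DecidableEq G]
    (D : Finset G) : Prop :=
  ∃ n r : ℕ, IsPartialDifferenceSet D ((n : ℤ) ^ 2) ((r : ℤ) * (n + 1))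
    (-(n : ℤ) + (r : ℤ) ^ 2 + 3 * r) ((r : ℤ) ^ 2 + r)

open Finset

/-! Let `w = 1 + f₀ + f₁ + f₂` for a bent triple, so that `w / 4` is the indicator of the set where
all `fᵢ = 1`. Expanding the autocorrelation of `w` at `g ≠ 0` leaves `|G| + 6e + 2e(f₀ + f₁ +
f₂)(g)`, which depends only on whether `g` lies in that set (`sum_weight_mul`). Discarding `0` gives
a PDS, of negative Latin square type when `e = -n`, `|G| = n²` and `n = 4(r + 1)`. Under direct
products `e` is multiplicative (`prod`), so triples with `e = 4` and `e = -4` on both `ℤ₄²` and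
`ℤ₂⁴` suffice: exactly one negative factor among `l` gives `e = -4^l` (`nonempty_of_le`). -/

/-- Three `±1`-valued functions on `G`, closed under multiplication like the nontrivial characters
of the Klein four-group, each of them perfect (vanishing periodic autocorrelation), whose
cross-correlations are the constant `e` times the third function. Equivalently, the components of a
vectorial bent function `G → (ZMod 2)²` whose dual is again vectorial. -/
structure BentTriple (G : Type*) [AddCommGroup G] [Fintype G] (e : ℤ) where
  sign : ZMod 3 → G → ℤ
  sign_eq : ∀ i x, sign i x = 1 ∨ sign i x = -1
  sign_mul : ∀ i x, sign i x * sign (i + 1) x = sign (i + 2) x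
  sign_neg : ∀ i x, sign i (-x) = sign i x
  sum_sign : ∀ i, ∑ x, sign i x = e
  autocorrelation : ∀ i g, g ≠ 0 → ∑ x, sign i x * sign i (x + g) = 0
  crosscorrelation : ∀ i g, ∑ x, sign i x * sign (i + 1) (x + g) = e * sign (i + 2) g

/-! ### Transport and products of bent triples. -/

namespace BentTriple

variable {G H : Type*} [AddCommGroup G] [Fintype G] [AddCommGroup H] [Fintype H] {d e : ℤ}

def congr (T : BentTriple G e) (φ : H ≃+ G) : BentTriple H e where
  sign i x := T.sign i (φ x)
  sign_eq i x := T.sign_eq i _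
  sign_mul i x := T.sign_mul i _
  sign_neg i x := by rw [map_neg, T.sign_neg]
  sum_sign i := (φ.toEquiv.sum_comp (T.sign i)).trans (T.sum_sign i)
  autocorrelation i g hg := by
    rw [← T.autocorrelation i (φ g) (by simpa using hg)]
    simp only [map_add]
    exact φ.toEquiv.sum_comp fun x => T.sign i x * T.sign i (x + φ g)
  crosscorrelation i g := by
    rw [← T.crosscorrelation i (φ g)]
    simp only [map_add]
    exact φ.toEquiv.sum_comp fun x => T.sign i x * T.sign (i + 1) (x + φ g)

/-- Correlations over a product group factor; the autocorrelation vanishes as soon as one coordinate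
of the shift is nonzero. -/
def prod (S : BentTriple G d) (T : BentTriple H e) : BentTriple (G × H) (d * e) where
  sign i x := S.sign i x.1 * T.sign i x.2
  sign_eq i x := by
    rcases S.sign_eq i x.1 with h | h <;> rcases T.sign_eq i x.2 with h' | h' <;> simp [h, h']
  sign_mul i x := by rw [← S.sign_mul, ← T.sign_mul]; ring
  sign_neg i x := by simp [S.sign_neg, T.sign_neg]
  sum_sign i := by
    rw [Fintype.sum_prod_type, ← Finset.sum_mul_sum, S.sum_sign, T.sum_sign]
  autocorrelation i g hg := by
    simp only [Fintype.sum_prod_type, Prod.fst_add, Prod.snd_add,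
      mul_mul_mul_comm (S.sign _ _) (T.sign _ _)]
    rw [← Finset.sum_mul_sum]
    by_cases h : g.1 = 0
    · rw [T.autocorrelation i g.2 fun h' => hg (Prod.ext h h'), mul_zero]
    · rw [S.autocorrelation i g.1 h, zero_mul]
  crosscorrelation i g := by
    simp only [Fintype.sum_prod_type, Prod.fst_add, Prod.snd_add,
      mul_mul_mul_comm (S.sign _ _) (T.sign _ _)]
    rw [← Finset.sum_mul_sum, S.crosscorrelation, T.crosscorrelation]
    ring

def ofSubsingleton [Subsingleton G] : BentTriple G 1 where
  sign _ _ := 1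
  sign_eq _ _ := Or.inl rfl
  sign_mul _ _ := rfl
  sign_neg _ _ := rfl
  sum_sign _ := by
    simpa using Fintype.card_eq_one_iff_nonempty_unique.2 ⟨⟨⟨0⟩, fun _ => Subsingleton.elim _ _⟩⟩
  autocorrelation _ g hg := (hg (Subsingleton.elim _ _)).elim
  crosscorrelation _ _ := by
    simpa using Fintype.card_eq_one_iff_nonempty_unique.2 ⟨⟨⟨0⟩, fun _ => Subsingleton.elim _ _⟩⟩

/-! ### The four building blocks, on groups of order 16. -/

/-- The nontrivial characters of the Klein four-group. -/
def kleinSign (i : ZMod 3) (v : ZMod 2 × ZMod 2) : ℤ :=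
  if i = 0 then (if v.1 = 0 then 1 else -1)
  else if i = 1 then (if v.2 = 0 then 1 else -1)
  else (if v.1 = v.2 then 1 else -1)

theorem kleinSign_eq : ∀ i v, kleinSign i v = 1 ∨ kleinSign i v = -1 := by decide

theorem kleinSign_mul : ∀ i v, kleinSign i v * kleinSign (i + 1) v = kleinSign (i + 2) v := by
  decide

def ofKlein (f : G → ZMod 2 × ZMod 2) (hneg : ∀ x, f (-x) = f x)
    (hsum : ∀ i, ∑ x, kleinSign i (f x) = e)
    (hauto : ∀ i g, g ≠ 0 → ∑ x, kleinSign i (f x) * kleinSign i (f (x + g)) = 0)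
    (hcross : ∀ i g, ∑ x, kleinSign i (f x) * kleinSign (i + 1) (f (x + g)) =
      e * kleinSign (i + 2) (f g)) : BentTriple G e where
  sign i x := kleinSign i (f x)
  sign_eq _ _ := kleinSign_eq _ _
  sign_mul _ _ := kleinSign_mul _ _
  sign_neg i x := by rw [hneg]
  sum_sign := hsum
  autocorrelation := hauto
  crosscorrelation := hcross

/-- The nonzero values are taken on the nonzero elements of three cyclic subgroups of order `4`
with trivial pairwise intersections. -/
def spreadFunction (x : ZMod 4 × ZMod 4) : ZMod 2 × ZMod 2 :=
  if x = 0 then 0 else if x.2 = 0 then (0, 1) else if x.1 = 0 then (1, 0)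
  else if x.1 = x.2 then (1, 1) else 0

/-- The three fibres over nonzero values are `{±a, ±b, 2(a + b)}` for `(a, b)` equal to
`((1, 0), (0, 1))`, `((2, 1), (1, 1))` and `((1, 2), (1, 3))`. -/
def clebschFunction (x : ZMod 4 × ZMod 4) : ZMod 2 × ZMod 2 :=
  if x = 0 then 0
  else if x ∈ [(1, 0), (3, 0), (0, 1), (0, 3), (2, 2)] then (0, 1)
  else if x ∈ [(2, 1), (2, 3), (1, 1), (3, 3), (2, 0)] then (1, 0)
  else (1, 1)

/-- The quadratic form `x * y` over the field with four elements, with respect to a basis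
`1, ω` such that `ω ^ 2 = ω + 1`. -/
def hyperbolicForm (z : (ZMod 2 × ZMod 2) × ZMod 2 × ZMod 2) : ZMod 2 × ZMod 2 :=
  let ((x, x'), (y, y')) := z
  (x * y + x' * y', x * y' + x' * y + x' * y')

/-- The quadratic form `x ^ 2 + x * y + ω * y ^ 2` over the field with four elements, with respect
to a basis `1, ω` such that `ω ^ 2 = ω + 1`. -/
def ellipticForm (z : (ZMod 2 × ZMod 2) × ZMod 2 × ZMod 2) : ZMod 2 × ZMod 2 :=
  let ((x, x'), (y, y')) := z
  hyperbolicForm z + (x + x' + y', x' + y)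

def spread : BentTriple (ZMod 4 × ZMod 4) 4 :=
  ofKlein spreadFunction (by decide +kernel) (by decide +kernel) (by decide +kernel)
    (by decide +kernel)

def clebsch : BentTriple (ZMod 4 × ZMod 4) (-4) :=
  ofKlein clebschFunction (by decide +kernel) (by decide +kernel) (by decide +kernel)
    (by decide +kernel)

def hyperbolic : BentTriple ((ZMod 2 × ZMod 2) × ZMod 2 × ZMod 2) 4 :=
  ofKlein hyperbolicForm (by decide +kernel) (by decide +kernel) (by decide +kernel)
    (by decide +kernel)

/-- The form is anisotropic because `ω` has trace `1`. Scaling then shows that each nonzero value is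
taken 5 times, whence `e = 1 + 5 - 10 = -4`. -/
def elliptic : BentTriple ((ZMod 2 × ZMod 2) × ZMod 2 × ZMod 2) (-4) :=
  ofKlein ellipticForm (by decide +kernel) (by decide +kernel) (by decide +kernel)
    (by decide +kernel)

def finAddEquiv (R : Type*) [AddCommGroup R] (m n : ℕ) :
    (Fin (m + n) → R) ≃+ (Fin m → R) × (Fin n → R) :=
  { (Fin.appendEquiv m n).symm with
    map_add' := fun _ _ => rfl }

def finTwoEquiv (R : Type*) [AddCommGroup R] : (Fin 2 → R) ≃+ R × R :=
  { finTwoArrowEquiv R with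
    map_add' := fun _ _ => rfl }

def finFourEquiv (R : Type*) [AddCommGroup R] : (Fin 4 → R) ≃+ (R × R) × R × R :=
  (finAddEquiv R 2 2).trans ((finTwoEquiv R).prodCongr (finTwoEquiv R))

/-- The negative sign needs `j ≠ 0`: on the trivial group `e = -1` would make all three functions
`-1`, contradicting closure under multiplication. -/
theorem nonempty_pi {R : Type*} [AddCommGroup R] [Fintype R] {m : ℕ}
    (h : Nonempty (BentTriple (Fin m → R) 4)) (h' : Nonempty (BentTriple (Fin m → R) (-4)))
    (j n : ℕ) (hn : n = m * j) :
    Nonempty (BentTriple (Fin n → R) (4 ^ j)) ∧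
      (j ≠ 0 → Nonempty (BentTriple (Fin n → R) (-4 ^ j))) := by
  subst hn
  induction j with
  | zero => exact ⟨⟨by simpa using (ofSubsingleton (G := Fin 0 → R))⟩, fun h => (h rfl).elim⟩
  | succ j ih =>
    obtain ⟨⟨T⟩, -⟩ := ih
    obtain ⟨S⟩ := h
    obtain ⟨S'⟩ := h'
    constructor
    · exact ⟨by rw [pow_succ]; exact (T.prod S).congr (finAddEquiv R (m * j) m)⟩
    -- Only the last factor is negative, so the positive half of the induction hypothesis suffices.
    · exact fun _ => ⟨by
        rw [pow_succ, ← mul_neg]; exact (T.prod S').congr (finAddEquiv R (m * j) m)⟩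

theorem nonempty_of_le {l k : ℕ} (hl : 1 ≤ l) (hk : k ≤ l) :
    Nonempty (BentTriple ((Fin (2 * k) → ZMod 4) × (Fin (4 * l - 4 * k) → ZMod 2)) (-4 ^ l)) := by
  obtain ⟨⟨S⟩, hS⟩ := nonempty_pi ⟨spread.congr (finTwoEquiv _)⟩ ⟨clebsch.congr (finTwoEquiv _)⟩
    k (2 * k) rfl
  obtain ⟨⟨T⟩, hT⟩ := nonempty_pi ⟨hyperbolic.congr (finFourEquiv _)⟩
    ⟨elliptic.congr (finFourEquiv _)⟩ (l - k) (4 * l - 4 * k) (by omega)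
  have hpow : (4 : ℤ) ^ l = 4 ^ k * 4 ^ (l - k) := by rw [← pow_add]; congr 1; omega
  rw [hpow]
  -- The negative factor must come from a nontrivial part; if `k = 0`, then `l - k ≥ 1`.
  rcases eq_or_ne k 0 with h | h
  · obtain ⟨T'⟩ := hT (by omega)
    exact ⟨by rw [← mul_neg]; exact S.prod T'⟩
  · obtain ⟨S'⟩ := hS h
    exact ⟨by rw [← neg_mul]; exact S'.prod T⟩

/-! ### Autocorrelation of the weight. -/

theorem sign_zero (T : BentTriple G e) (he : e ≠ 0) (i : ZMod 3) : T.sign i 0 = 1 := by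
  -- At shift `0` the cross-correlation is the sum of the third function, namely `e`.
  have h := T.crosscorrelation (i + 1) 0
  simp only [add_zero, T.sign_mul, T.sum_sign] at h
  have h3 : i + 1 + 2 = i := by rw [add_assoc, show (1 + 2 : ZMod 3) = 0 from rfl, add_zero]
  rw [h3] at h
  exact mul_left_cancel₀ he (by rw [← h, mul_one])

/-- Exchanging the two functions replaces `g` by `-g`, and the third function is even. -/
theorem crosscorrelation_symm (T : BentTriple G e) (i : ZMod 3) (g : G) :
    ∑ x, T.sign (i + 1) x * T.sign i (x + g) = e * T.sign (i + 2) g := by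
  rw [← T.sign_neg (i + 2), ← T.crosscorrelation,
    ← Equiv.sum_comp (Equiv.addRight g) fun x => T.sign i x * T.sign (i + 1) (x + -g)]
  simp [mul_comm]

/-- `4` times the indicator function of the set on which all three functions equal `1`. -/
def weight (T : BentTriple G e) (x : G) : ℤ :=
  1 + T.sign 0 x + T.sign 1 x + T.sign 2 x

theorem weight_eq (T : BentTriple G e) (x : G) : T.weight x = 4 ∨ T.weight x = 0 := by
  have h : T.sign 0 x * T.sign 1 x = T.sign 2 x := T.sign_mul 0 x
  unfold weight
  rw [← h]
  rcases T.sign_eq 0 x with h0 | h0 <;> rcases T.sign_eq 1 x with h1 | h1 <;> simp [h0, h1]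

theorem weight_zero (T : BentTriple G e) (he : e ≠ 0) : T.weight 0 = 4 := by
  simp [weight, T.sign_zero he]

theorem weight_neg (T : BentTriple G e) (x : G) : T.weight (-x) = T.weight x := by
  simp [weight, T.sign_neg]

theorem sum_weight (T : BentTriple G e) : ∑ x, T.weight x = Fintype.card G + 3 * e := by
  simp only [weight, Finset.sum_add_distrib, T.sum_sign]
  simp
  ring

theorem sum_weight_mul (T : BentTriple G e) {g : G} (hg : g ≠ 0) :
    ∑ x, T.weight x * T.weight (x + g) = Fintype.card G + 4 * e + 2 * e * T.weight g := by
  have hshift (i : ZMod 3) : ∑ x, T.sign i (x + g) = e :=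
    (Equiv.sum_comp (Equiv.addRight g) (T.sign i)).trans (T.sum_sign i)
  have h01 : ∑ x, T.sign 0 x * T.sign 1 (x + g) = e * T.sign 2 g := T.crosscorrelation 0 g
  have h12 : ∑ x, T.sign 1 x * T.sign 2 (x + g) = e * T.sign 0 g := T.crosscorrelation 1 g
  have h20 : ∑ x, T.sign 2 x * T.sign 0 (x + g) = e * T.sign 1 g := T.crosscorrelation 2 g
  have h10 : ∑ x, T.sign 1 x * T.sign 0 (x + g) = e * T.sign 2 g := T.crosscorrelation_symm 0 g
  have h21 : ∑ x, T.sign 2 x * T.sign 1 (x + g) = e * T.sign 0 g := T.crosscorrelation_symm 1 g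
  have h02 : ∑ x, T.sign 0 x * T.sign 2 (x + g) = e * T.sign 1 g := T.crosscorrelation_symm 2 g
  simp only [weight, add_mul, mul_add, one_mul, mul_one, Finset.sum_add_distrib, T.sum_sign,
    hshift, h01, h12, h20, h10, h21, h02, T.autocorrelation _ g hg]
  simp
  ring

/-! ### The partial difference set of a triple. -/

variable [DecidableEq G]

def diffSet (T : BentTriple G e) : Finset G := {x | x ≠ 0 ∧ T.weight x = 4}

theorem mem_diffSet (T : BentTriple G e) {x : G} : x ∈ T.diffSet ↔ x ≠ 0 ∧ T.weight x = 4 := by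
  simp [diffSet]

theorem four_mul_indicator_diffSet (T : BentTriple G e) (he : e ≠ 0) (x : G) :
    4 * (if x ∈ T.diffSet then 1 else 0 : ℤ) = T.weight x - 4 * (if x = 0 then 1 else 0) := by
  simp only [T.mem_diffSet]
  rcases eq_or_ne x 0 with rfl | h
  · simp [T.weight_zero he]
  · rcases T.weight_eq x with h' | h' <;> simp [h, h']

theorem four_mul_card_diffSet (T : BentTriple G e) (he : e ≠ 0) :
    4 * (T.diffSet.card : ℤ) = Fintype.card G + 3 * e - 4 := by
  have h : (T.diffSet.card : ℤ) = ∑ x, if x ∈ T.diffSet then 1 else 0 := by simp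
  rw [h, Finset.mul_sum]
  simp only [T.four_mul_indicator_diffSet he, Finset.sum_sub_distrib, T.sum_weight]
  simp

theorem card_filter_offDiag_sub (D : Finset G) {g : G} (hg : g ≠ 0) :
    ((D.offDiag.filter fun p => p.1 - p.2 = g).card : ℤ) =
      ∑ x, (if x ∈ D then 1 else 0) * (if x + g ∈ D then 1 else 0) := by
  have h : (D.offDiag.filter fun p => p.1 - p.2 = g).card =
      (Finset.univ.filter fun x => x ∈ D ∧ x + g ∈ D).card := by
    refine Finset.card_bij' (fun p _ => p.2) (fun x _ => (x + g, x)) ?_ ?_ ?_ ?_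
    · rintro ⟨a, b⟩ hp
      simp only [Finset.mem_filter, Finset.mem_offDiag] at hp
      obtain ⟨⟨ha, hb, -⟩, rfl⟩ := hp
      simp [ha, hb]
    · intro x hx
      simp only [Finset.mem_filter, Finset.mem_univ, true_and] at hx
      simp [hx.1, hx.2, hg]
    · rintro ⟨a, b⟩ hp
      simp only [Finset.mem_filter, Finset.mem_offDiag] at hp
      obtain ⟨-, rfl⟩ := hp
      simp
    · intro x _
      rfl
  rw [h, Finset.card_filter]
  push_cast
  refine Finset.sum_congr rfl fun x _ => ?_
  by_cases h1 : x ∈ D <;> by_cases h2 : x + g ∈ D <;> simp [h1, h2]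

theorem sixteen_mul_card_filter (T : BentTriple G e) (he : e ≠ 0) {g : G} (hg : g ≠ 0) :
    16 * ((T.diffSet.offDiag.filter fun p => p.1 - p.2 = g).card : ℤ) =
      Fintype.card G + 4 * e + (2 * e - 8) * T.weight g := by
  -- Removing `0` from the set costs the terms `x = 0` and `x = -g`, each contributing `4 * T.weight
  -- g` to the sum; they do not overlap since `g ≠ 0`.
  have hsplit (x : G) : 16 * ((if x ∈ T.diffSet then 1 else 0) *
      (if x + g ∈ T.diffSet then 1 else 0) : ℤ) = T.weight x * T.weight (x + g)
        - 4 * (if x = 0 then T.weight (x + g) else 0)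
        - 4 * (if x = -g then T.weight x else 0) := by
    have h1 := T.four_mul_indicator_diffSet he x
    have h2 := T.four_mul_indicator_diffSet he (x + g)
    calc _ = (4 * (if x ∈ T.diffSet then 1 else 0 : ℤ)) *
          (4 * (if x + g ∈ T.diffSet then 1 else 0 : ℤ)) := by ring
      _ = _ := by
        rw [h1, h2]
        simp only [← eq_neg_iff_add_eq_zero]
        by_cases hx : x = 0
        · have : (0 : G) ≠ -g := by simpa [eq_comm] using hg
          subst hx
          simp [this]
          ring
        · by_cases hx' : x = -g <;> simp [hx, hx', hg]
          ring
  rw [card_filter_offDiag_sub _ hg, Finset.mul_sum]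
  simp only [hsplit, Finset.sum_sub_distrib, ← Finset.mul_sum, T.sum_weight_mul hg]
  simp [T.weight_neg]
  ring

/-- The parameters are those of negative Latin square type with `n = 4 * (r + 1)`. -/
theorem isPartialDifferenceSet_diffSet {r : ℕ} (T : BentTriple G (-(4 * (r + 1))))
    (hcard : (Fintype.card G : ℤ) = (4 * (r + 1)) ^ 2) :
    IsPartialDifferenceSet T.diffSet ((4 * (r + 1)) ^ 2) (r * (4 * (r + 1) + 1))
      (-(4 * (r + 1)) + (r : ℤ) ^ 2 + 3 * r) ((r : ℤ) ^ 2 + r) := by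
  have he : (-(4 * (r + 1)) : ℤ) ≠ 0 := by
    rw [neg_ne_zero]; positivity
  refine ⟨hcard, ?_, fun g hgD hg => ?_, fun g hgD hg => ?_⟩
  · have h := T.four_mul_card_diffSet he
    rw [hcard] at h
    linarith
  · have h := T.sixteen_mul_card_filter he hg
    rw [hcard, (T.mem_diffSet.1 hgD).2] at h
    linarith
  · have h := T.sixteen_mul_card_filter he hg
    have hw : T.weight g = 0 :=
      (T.weight_eq g).resolve_left fun h' => hgD (T.mem_diffSet.2 ⟨hg, h'⟩)
    rw [hcard, hw] at h
    linarith

end BentTriple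

theorem corollary2p2 (l k : ℕ) (hl : 1 ≤ l) (hk : k ≤ l) (hexc : ¬ (k = l ∧ Even l)) :
    ∃ D : Finset ((Fin (2 * k) → ZMod 4) × (Fin (4 * l - 4 * k) → ZMod 2)),
      IsPartialDifferenceSet D ((4 : ℤ) ^ (2 * l))
        (((4 : ℤ) ^ l + 1) * ((4 : ℤ) ^ (l - 1) - 1))
        ((4 : ℤ) ^ (2 * l - 2) - 3 * (4 : ℤ) ^ (l - 1) - 2)
        ((4 : ℤ) ^ (2 * l - 2) - (4 : ℤ) ^ (l - 1)) ∧
      IsNegativeLatinSquareType D := by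
  obtain ⟨T⟩ := BentTriple.nonempty_of_le hl hk
  -- With `n = 4 ^ l`, the relation `n = 4 * (r + 1)` forces `r = 4 ^ (l - 1) - 1`.
  obtain ⟨r, hr⟩ : ∃ r : ℕ, 4 ^ (l - 1) = r + 1 :=
    Nat.exists_eq_succ_of_ne_zero (pow_ne_zero _ four_ne_zero)
  have hr' : (4 : ℤ) ^ (l - 1) = r + 1 := by exact_mod_cast hr
  have hn : (4 : ℤ) ^ l = 4 * (r + 1) := by
    rw [← hr', ← pow_succ']; congr 1; omega
  have hsq : (4 : ℤ) ^ (2 * l) = (4 * (r + 1)) ^ 2 := by rw [← hn, ← pow_mul, mul_comm]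
  have hsq' : (4 : ℤ) ^ (2 * l - 2) = (r + 1) ^ 2 := by
    rw [← hr', ← pow_mul]; congr 1; omega
  rw [hn] at T
  have hcard : (Fintype.card ((Fin (2 * k) → ZMod 4) × (Fin (4 * l - 4 * k) → ZMod 2)) : ℤ) =
      (4 * (r + 1)) ^ 2 := by
    rw [← hsq]
    simp only [Fintype.card_prod, Fintype.card_fun, ZMod.card, Fintype.card_fin]
    push_cast
    rw [show (4 : ℤ) = 2 ^ 2 by norm_num, ← pow_mul, ← pow_mul, ← pow_add]
    congr 1
    omega
  have hD := T.isPartialDifferenceSet_diffSet hcard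
  refine ⟨T.diffSet, ?_, 4 * (r + 1), r, by push_cast; exact hD⟩
  rw [hsq, hn, hr', hsq']
  convert hD using 1 <;> ring
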